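/- Let $G$ be a finite, simple, connected graph with adjacency matrix $A$, and let $k\ge 0$ be an integer. Let $\operatorname{Spec}_A(G)$ denote the set of distinct eigenvalues of $A$; $G$ is called integral if $\operatorname{Spec}_A(G)\subset\mathbb{Z}$. Let $\mathcal{A}$ be the set of arcs $(u,v)$ with $uv$ an edge of $G$; the arc $a=(u,v)$ has terminus $t(a)=v$ and inverse $a^{-1}=(v,u)$. Let $U=S(2d^*d-I)\in\mathbb{C}^{\mathcal{A}\times\mathcal{A}}$ be the time evolution matrix of the Grover walk on $G$, where $d\in\mathbb{C}^{V(G)\times\mathcal{A}}$ and $S\in\mathbb{C}^{\mathcal{A}\times\mathcal{A}}$ are given by $d_{xa}=\frac{1}{\sqrt{\deg x}}\,\delta_{x,t(a)}$ and $S_{ab}=\delta_{a,b^{-1}}$. The graph $G$ is called periodic if $U^\tau=I$ for some positive integer $\tau$ (the least such $\tau$ is its period). Then $G$ is $k$-regular, integral and periodic if and only if at least one of the following holds: 1. $k=2$ and $G$ is isomorphic to the cycle $C_6$; 2. $G$ is isomorphic to the complete bipartite graph $K_{k,k}$; 3. $k$ is even and $G$ is isomorphic to the complete tripartite graph $K_{\frac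 k2,\frac k2,\frac k2}$; 4. $G$ is $k$-regular and $\operatorname{Spec}_A(G)=\{k,\pm\frac k2,0\}$; 5. $G$ is $k$-regular and $\operatorname{Spec}_A(G)=\{\pm k,\pm\frac k2,0\}$. -/

import Mathlib

noncomputable section

namespace GroverWalk

open Matrix

variable {V : Type*} [Fintype V] [DecidableEq V]

/-- The boundary matrix `d`, indexed by vertices and arcs: `d x a = (1 / √(deg x)) δ_{x, t(a)}`,
where `t(a) = a.snd` is the terminus of the arc `a`. -/
def boundaryMatrix (G : SimpleGraph V) [DecidableRel G.Adj] : Matrix V G.Dart ℂ :=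
  Matrix.of fun x a => if x = a.snd then ((1 / Real.sqrt (G.degree x : ℝ) : ℝ) : ℂ) else 0

/-- The shift matrix `S a b = δ_{a, b⁻¹}`, where `b⁻¹` is the arc `b` reversed. -/
def shiftMatrix (G : SimpleGraph V) [DecidableRel G.Adj] : Matrix G.Dart G.Dart ℂ :=
  Matrix.of fun a b => if a = b.symm then 1 else 0

/-- The time evolution matrix `U = S (2 d* d - I)` of the Grover walk on `G`. -/
def timeEvolution (G : SimpleGraph V) [DecidableRel G.Adj] : Matrix G.Dart G.Dart ℂ :=
  shiftMatrix G * ((2 : ℂ) • ((boundaryMatrix G)ᴴ * boundaryMatrix G) - 1)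

/-- `G` is periodic with period `τ`: `τ` is the least positive integer with `U ^ τ = I`. -/
def IsPeriodicWithPeriod (G : SimpleGraph V) [DecidableRel G.Adj] (τ : ℕ) : Prop :=
  0 < τ ∧ timeEvolution G ^ τ = 1 ∧ ∀ j : ℕ, 0 < j → j < τ → timeEvolution G ^ j ≠ 1

/-- `G` is periodic (with respect to its Grover walk). -/
def IsPeriodic (G : SimpleGraph V) [DecidableRel G.Adj] : Prop :=
  ∃ τ : ℕ, IsPeriodicWithPeriod G τ

/-- The adjacency spectrum of `G`: the set of distinct eigenvalues of its adjacency matrix. -/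
def adjSpectrum (G : SimpleGraph V) [DecidableRel G.Adj] : Set ℂ :=
  spectrum ℂ (G.adjMatrix ℂ)

/-- `G` is integral: all its adjacency eigenvalues are integers. -/
def IsIntegralGraph (G : SimpleGraph V) [DecidableRel G.Adj] : Prop :=
  ∀ z ∈ adjSpectrum G, ∃ n : ℤ, z = (n : ℂ)

end GroverWalk

end

/-!
Let `A` be the adjacency matrix of a connected `k`-regular graph with `k > 0`, and `U` the time
evolution of its Grover walk.

**Periodicity in terms of `A`.** The walk satisfies `d d* = I` and `d S d* = A / k`, so that
`W = U + U⁻¹` acts on the image of `d*` as `2 A / k` (`add_inverseEvolution_mul_conjTranspose`).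
If `U ^ τ = 1` and `n` is an integer eigenvalue of `A`, then `2 n / k = z + z⁻¹` for a root of unity
`z`; this is a rational algebraic integer of absolute value at most `2`, so `n` lies in
`{±k, ±k/2, 0}` (`adjSpectrum_subset_of_isPeriodic`). Conversely, if all eigenvalues lie in this set,
then `q(W) d* = 0` for `q = X (X² - 1) (X² - 4)`. As `W` commutes with `S` and
`W = 2 S d* d + 2 d* d S - 2 S`, this gives `q(W) W = -2 q(W) S` and so `q(W) (W² - 4) = 0`.
Hence `U ^ 12 - 1` is nilpotent, and it vanishes because `U` is unitary
(`timeEvolution_pow_twelve`). Eigenvalues being algebraic integers, integrality is then automatic.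

**Classification of the spectra.** It remains to find the integral graphs with spectrum inside
`{±k, ±k/2, 0}` (`classification_of_spectrum_subset`). The tool is that a polynomial vanishing at
all eigenvalues other than `k` turns `A` into a matrix with all entries equal
(`exists_aeval_adjMatrix_apply_eq`). If the spectrum lies in `{k, -t, 0}`, then `A² + t A` is constant;
this makes `G` complete multipartite with parts of size `t`, where `t = k` gives `K_{k,k}` and
`t = k/2` gives the complete tripartite graph. Otherwise `k/2` is an eigenvalue (if `-k` and `-k/2`
are both eigenvalues, `G` is bipartite and its spectrum is symmetric). Then so is `-k/2`, by symmetry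
if `-k` is an eigenvalue, and because the trace of `A` vanishes if it is not. When `0` is an
eigenvalue as well, the spectrum is one of the two listed sets. When it is not, the spectrum
`{k, ±k/2}` is impossible (`not_spectrum_subset_of_half_mem`) and `{±k, ±k/2}` forces the hexagon
(`iso_cycleGraph_six_of_spectrum_subset`).

For `k = 0` the graph is a single vertex without arcs, and its spectrum `{0}` is the first of the
two listed sets.
-/

namespace GroverWalk

open Matrix Polynomial

section

/-! ### Eigenvalues of adjacency matrices -/

/-- A real polynomial vanishing on the spectrum of a Hermitian matrix annihilates the matrix. -/
theorem aeval_eq_zero_of_isHermitian {n : Type*} [Fintype n] [DecidableEq n] {A : Matrix n n ℝ}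
    (hA : A.IsHermitian) (q : ℝ[X]) (hq : ∀ x ∈ spectrum ℝ A, q.eval x = 0) : aeval A q = 0 := by
  have hA' : IsSelfAdjoint A := hA
  rw [← cfc_polynomial q A hA', cfc_congr (g := fun _ => 0) (fun x hx => hq x hx), cfc_const_zero]

variable {V : Type*}

theorem isHermitian_adjMatrix (G : SimpleGraph V) [DecidableRel G.Adj] :
    (G.adjMatrix ℝ).IsHermitian := by
  rw [IsHermitian, conjTranspose_eq_transpose_of_trivial, SimpleGraph.transpose_adjMatrix]

theorem mem_spectrum_iff_exists_mulVec_eq [Fintype V] [DecidableEq V]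
    {K : Type*} [Field K] {A : Matrix V V K} {x : K} :
    x ∈ spectrum K A ↔ ∃ v, v ≠ 0 ∧ A *ᵥ v = x • v := by
  rw [← spectrum_toLin', ← Module.End.hasEigenvalue_iff_mem_spectrum]
  constructor
  · intro h
    obtain ⟨v, hv⟩ := h.exists_hasEigenvector
    exact ⟨v, hv.2, by simpa using hv.apply_eq_smul⟩
  · rintro ⟨v, hv, h⟩
    exact Module.End.hasEigenvalue_of_hasEigenvector
      (x := v) ⟨Module.End.mem_eigenspace_iff.2 (by simpa using h), hv⟩

theorem map_adjMatrix_ofReal (G : SimpleGraph V) [DecidableRel G.Adj] :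
    (G.adjMatrix ℝ).map (algebraMap ℝ ℂ) = G.adjMatrix ℂ := by
  ext i j
  simp [SimpleGraph.adjMatrix_apply, apply_ite]

theorem ofReal_mem_adjSpectrum_iff [Fintype V] [DecidableEq V]
    (G : SimpleGraph V) [DecidableRel G.Adj] (x : ℝ) :
    (x : ℂ) ∈ adjSpectrum G ↔ x ∈ spectrum ℝ (G.adjMatrix ℝ) := by
  rw [adjSpectrum, mem_spectrum_iff_isRoot_charpoly, mem_spectrum_iff_isRoot_charpoly,
    ← map_adjMatrix_ofReal, charpoly_map]
  exact isRoot_map_iff (algebraMap ℝ ℂ).injective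

theorem adjSpectrum_eq_image [Fintype V] [DecidableEq V]
    (G : SimpleGraph V) [DecidableRel G.Adj] :
    adjSpectrum G = (fun x : ℝ => (x : ℂ)) '' spectrum ℝ (G.adjMatrix ℝ) := by
  ext z
  constructor
  · intro hz
    have hA : (G.adjMatrix ℂ).IsHermitian := by
      ext i j
      simp [SimpleGraph.adjMatrix_apply, apply_ite, SimpleGraph.adj_comm]
    obtain ⟨x, -, rfl⟩ := hA.spectrum_eq_image_range.subset hz
    exact ⟨x, (ofReal_mem_adjSpectrum_iff G x).1 hz, rfl⟩
  · rintro ⟨x, hx, rfl⟩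
    exact (ofReal_mem_adjSpectrum_iff G x).2 hx

theorem isIntegral_of_mem_adjSpectrum [Fintype V] [DecidableEq V]
    {G : SimpleGraph V} [DecidableRel G.Adj] {z : ℂ}
    (hz : z ∈ adjSpectrum G) : IsIntegral ℤ z := by
  have hA : (G.adjMatrix ℤ).map (algebraMap ℤ ℂ) = G.adjMatrix ℂ := by
    ext i j
    simp [SimpleGraph.adjMatrix_apply, apply_ite]
  rw [adjSpectrum, mem_spectrum_iff_isRoot_charpoly, ← hA, charpoly_map] at hz
  exact ⟨_, charpoly_monic (G.adjMatrix ℤ), by rw [eval₂_eq_eval_map]; exact hz⟩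

theorem spectrum_adjMatrix_eq_of_iso [Fintype V] [DecidableEq V]
    {W : Type*} [Fintype W] [DecidableEq W] {G : SimpleGraph V}
    [DecidableRel G.Adj] {H : SimpleGraph W} [DecidableRel H.Adj] (f : G ≃g H) :
    spectrum ℝ (G.adjMatrix ℝ) = spectrum ℝ (H.adjMatrix ℝ) := by
  rw [← f.reindex_adjMatrix ℝ]
  exact (AlgEquiv.spectrum_eq (reindexAlgEquiv ℝ ℝ f.toEquiv) _).symm

theorem isRegularOfDegree_of_iso [Fintype V] {W : Type*} [Fintype W] {G : SimpleGraph V}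
    [DecidableRel G.Adj] {H : SimpleGraph W} [DecidableRel H.Adj] (f : G ≃g H) {k : ℕ}
    (hH : H.IsRegularOfDegree k) : G.IsRegularOfDegree k := fun v => by
  rw [← f.degree_eq v]
  exact hH (f v)

end

section

/-! ### Boundary and shift matrices of a regular graph -/

variable {V : Type*} [Fintype V] [DecidableEq V] {G : SimpleGraph V} [DecidableRel G.Adj]

theorem shiftMatrix_mul_apply {m : Type*} (M : Matrix G.Dart m ℂ) (a : G.Dart) (y : m) :
    (shiftMatrix G * M) a y = M a.symm y := by
  rw [mul_apply, Finset.sum_eq_single a.symm]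
  · simp [shiftMatrix]
  · intro b _ hb
    have : a ≠ b.symm := fun h => hb (by rw [h, SimpleGraph.Dart.symm_symm])
    simp [shiftMatrix, this]
  · simp

theorem shiftMatrix_mul_self : shiftMatrix G * shiftMatrix G = 1 := by
  ext a b
  rw [shiftMatrix_mul_apply]
  simp [shiftMatrix, one_apply, SimpleGraph.Dart.symm_involutive.injective.eq_iff]

omit [Fintype V] in
theorem conjTranspose_shiftMatrix : (shiftMatrix G)ᴴ = shiftMatrix G := by
  ext a b
  have : b = a.symm ↔ a = b.symm := SimpleGraph.Dart.symm_involutive.eq_iff.symm.trans eq_comm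
  simp [shiftMatrix, conjTranspose_apply, apply_ite, this]

variable {k : ℕ}

theorem boundaryMatrix_mul_star (hk : 0 < k) (hG : G.IsRegularOfDegree k) (x y : V)
    (a b : G.Dart) : boundaryMatrix G x a * star (boundaryMatrix G y b) =
      if x = a.snd ∧ y = b.snd then (1 / k : ℂ) else 0 := by
  have h : ((1 / Real.sqrt k : ℝ) : ℂ) * ((1 / Real.sqrt k : ℝ) : ℂ) = 1 / k := by
    have : (0 : ℝ) < k := by exact_mod_cast hk
    rw [← Complex.ofReal_mul, div_mul_div_comm, Real.mul_self_sqrt this.le]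
    simp
  simp only [boundaryMatrix, of_apply, hG.degree_eq, apply_ite star, star_zero,
    Complex.star_def, Complex.conj_ofReal, ite_and, mul_ite, ite_mul, mul_zero, zero_mul, h]
  split_ifs <;> rfl

theorem boundaryMatrix_mul_conjTranspose (hk : 0 < k) (hG : G.IsRegularOfDegree k) :
    boundaryMatrix G * (boundaryMatrix G)ᴴ = 1 := by
  ext x y
  have hk' : (k : ℂ) ≠ 0 := by exact_mod_cast hk.ne'
  simp only [mul_apply, conjTranspose_apply, boundaryMatrix_mul_star hk hG]
  rcases eq_or_ne x y with rfl | hxy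
  · have hcard : (Finset.univ.filter fun a : G.Dart => x = a.snd).card = k := by
      rw [← hG.degree_eq x, ← G.dart_fst_fiber_card_eq_degree x]
      exact Finset.card_bij (fun a _ => a.symm) (by simp +contextual)
        (fun a _ b _ h => SimpleGraph.Dart.symm_involutive.injective h)
        (fun b hb => ⟨b.symm, by simpa [eq_comm] using hb, by simp⟩)
    simp [← Finset.sum_filter, hcard, hk']
  · rw [one_apply_ne hxy]
    exact Finset.sum_eq_zero fun a _ => if_neg fun h => hxy (h.1.trans h.2.symm)

/-- The discriminant `d S d*` of the walk is the transition matrix `A / k` of the simple random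
walk. -/
theorem boundaryMatrix_mul_shiftMatrix_mul (hk : 0 < k) (hG : G.IsRegularOfDegree k) :
    boundaryMatrix G * (shiftMatrix G * (boundaryMatrix G)ᴴ) = (1 / k : ℂ) • G.adjMatrix ℂ := by
  ext x y
  rw [mul_apply]
  simp only [shiftMatrix_mul_apply, conjTranspose_apply, boundaryMatrix_mul_star hk hG]
  rw [Matrix.smul_apply, SimpleGraph.adjMatrix_apply]
  by_cases h : G.Adj x y
  · rw [Finset.sum_eq_single (⟨(y, x), h.symm⟩ : G.Dart)]
    · simp [h]
    · intro b _ hb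
      refine if_neg fun h' => hb ?_
      ext <;> simp [h'.1, h'.2]
    · simp
  · rw [if_neg h, smul_zero]
    refine Finset.sum_eq_zero fun a _ => if_neg fun h' => h ?_
    rw [h'.1, h'.2]
    exact a.adj.symm

/-! ### The evolution matrix and its inverse -/

/-- The inverse `(2 d* d - I) S` of the time evolution matrix `S (2 d* d - I)`. -/
noncomputable def inverseEvolution (G : SimpleGraph V) [DecidableRel G.Adj] :
    Matrix G.Dart G.Dart ℂ :=
  ((2 : ℂ) • ((boundaryMatrix G)ᴴ * boundaryMatrix G) - 1) * shiftMatrix G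

theorem coin_mul_self (hk : 0 < k) (hG : G.IsRegularOfDegree k) :
    ((2 : ℂ) • ((boundaryMatrix G)ᴴ * boundaryMatrix G) - 1) *
      ((2 : ℂ) • ((boundaryMatrix G)ᴴ * boundaryMatrix G) - 1) = 1 := by
  have h : (boundaryMatrix G)ᴴ * boundaryMatrix G * ((boundaryMatrix G)ᴴ * boundaryMatrix G) =
      (boundaryMatrix G)ᴴ * boundaryMatrix G := by
    rw [Matrix.mul_assoc, ← Matrix.mul_assoc (boundaryMatrix G),
      boundaryMatrix_mul_conjTranspose hk hG, Matrix.one_mul]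
  simp only [sub_mul, mul_sub, smul_mul_assoc, mul_smul_comm, h, mul_one, one_mul]
  module

theorem timeEvolution_mul_inverseEvolution (hk : 0 < k) (hG : G.IsRegularOfDegree k) :
    timeEvolution G * inverseEvolution G = 1 := by
  rw [timeEvolution, inverseEvolution, mul_assoc, ← mul_assoc _ _ (shiftMatrix G),
    coin_mul_self hk hG, one_mul, shiftMatrix_mul_self]

theorem conjTranspose_timeEvolution : (timeEvolution G)ᴴ = inverseEvolution G := by
  simp [timeEvolution, inverseEvolution, conjTranspose_mul, conjTranspose_shiftMatrix]

/-- `U + U⁻¹` acts on the image of `d*` as twice the transition matrix. -/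
theorem add_inverseEvolution_mul_conjTranspose (hk : 0 < k) (hG : G.IsRegularOfDegree k) :
    (timeEvolution G + inverseEvolution G) * (boundaryMatrix G)ᴴ =
      (boundaryMatrix G)ᴴ * ((2 / k : ℂ) • G.adjMatrix ℂ) := by
  have h1 : (2 / k : ℂ) • G.adjMatrix ℂ =
      (2 : ℂ) • (boundaryMatrix G * (shiftMatrix G * (boundaryMatrix G)ᴴ)) := by
    rw [boundaryMatrix_mul_shiftMatrix_mul hk hG, smul_smul]
    congr 1
    ring
  rw [h1, timeEvolution, inverseEvolution]
  simp only [Matrix.add_mul, Matrix.sub_mul, Matrix.mul_sub, Matrix.mul_smul, Matrix.smul_mul,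
    Matrix.mul_assoc, boundaryMatrix_mul_conjTranspose hk hG, Matrix.mul_one, Matrix.one_mul]
  module

end

section

/-! ### Eigenvalues of a periodic walk -/

theorem pow_eq_one_of_mulVec_eq_smul {n : Type*} [Fintype n] [DecidableEq n] {U : Matrix n n ℂ}
    {τ : ℕ} (hU : U ^ τ = 1) {z : ℂ} {w : n → ℂ} (hw : w ≠ 0) (h : U *ᵥ w = z • w) :
    z ^ τ = 1 := by
  have key : ∀ j : ℕ, U ^ j *ᵥ w = z ^ j • w := by
    intro j
    induction j with
    | zero => simp
    | succ j ih => rw [pow_succ, ← mulVec_mulVec, h, mulVec_smul, ih, smul_smul, pow_succ']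
  have := key τ
  rw [hU, one_mulVec] at this
  have h2 : (z ^ τ - 1) • w = 0 := by rw [sub_smul, ← this, one_smul, sub_self]
  rcases smul_eq_zero.1 h2 with h3 | h3
  · exact sub_eq_zero.1 h3
  · exact absurd h3 hw

/-- An eigenvalue `x` of `U + U⁻¹` splits as `z + z⁻¹`, where one of `z`, `z⁻¹` is an eigenvalue
of `U`: indeed `U² - x U + 1 = (U - z) (U - z⁻¹)`. -/
theorem exists_pow_eq_one_of_add_mulVec_eq_smul {n : Type*} [Fintype n] [DecidableEq n]
    {U U' : Matrix n n ℂ} (hUU' : U * U' = 1) {τ : ℕ} (hU : U ^ τ = 1) {x : ℂ} {w : n → ℂ}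
    (hw : w ≠ 0) (h : (U + U') *ᵥ w = x • w) : ∃ z : ℂ, z ^ τ = 1 ∧ x = z + z⁻¹ := by
  obtain ⟨z, hz⟩ : ∃ z : ℂ, z ^ 2 - x * z + 1 = 0 := by
    obtain ⟨s, hs⟩ := IsAlgClosed.exists_pow_nat_eq (x ^ 2 - 4) (n := 2) two_pos
    exact ⟨(x + s) / 2, by linear_combination hs / 4⟩
  have hz0 : z ≠ 0 := by
    rintro rfl
    simp at hz
  have hx : x = z + z⁻¹ := by
    field_simp
    linear_combination -hz
  have hquad : U *ᵥ U *ᵥ w = x • U *ᵥ w - w := by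
    have := congrArg (U *ᵥ ·) h
    simp only [add_mulVec, mulVec_add, mulVec_mulVec, hUU', one_mulVec, mulVec_smul] at this
    rw [mulVec_mulVec, ← this, add_sub_cancel_right]
  by_cases h0 : U *ᵥ w = z⁻¹ • w
  · have h1 := pow_eq_one_of_mulVec_eq_smul hU hw h0
    exact ⟨z, by rwa [inv_pow, inv_eq_one] at h1, hx⟩
  · refine ⟨z, pow_eq_one_of_mulVec_eq_smul hU (sub_ne_zero.2 h0) ?_, hx⟩
    rw [mulVec_sub, mulVec_smul, hquad, hx, add_smul, smul_sub, smul_smul, mul_inv_cancel₀ hz0,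
      one_smul]
    abel

/-- A rational number that is the sum of a root of unity and its inverse is an integer of
absolute value at most two. -/
theorem exists_int_of_eq_add_inv {τ : ℕ} (hτ : 0 < τ) {z : ℂ} (hz : z ^ τ = 1) {q : ℚ}
    (hq : (q : ℂ) = z + z⁻¹) : ∃ m : ℤ, (q : ℂ) = m ∧ -2 ≤ m ∧ m ≤ 2 := by
  have hroot : ∀ y : ℂ, y ^ τ = 1 → IsIntegral ℤ y := fun y hy =>
    IsIntegral.of_pow hτ (hy ▸ isIntegral_one)
  have hint : IsIntegral ℤ (algebraMap ℚ ℂ q) := by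
    rw [eq_ratCast, hq]
    exact (hroot z hz).add (hroot z⁻¹ (by rw [inv_pow, hz, inv_one]))
  rw [isIntegral_algebraMap_iff (algebraMap ℚ ℂ).injective,
    IsIntegrallyClosed.isIntegral_iff] at hint
  obtain ⟨m, hm⟩ := hint
  have hqm : (q : ℂ) = m := by
    rw [← hm]
    simp
  have hnorm : ‖z‖ = 1 := Complex.norm_eq_one_of_pow_eq_one hz hτ.ne'
  have hle : ‖(m : ℂ)‖ ≤ 2 := by
    rw [← hqm, hq]
    refine (norm_add_le _ _).trans ?_
    rw [norm_inv, hnorm]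
    norm_num
  rw [Complex.norm_intCast] at hle
  have := abs_le.1 hle
  exact ⟨m, hqm, by exact_mod_cast this.1, by exact_mod_cast this.2⟩

variable {V : Type*} [Fintype V] [DecidableEq V] {G : SimpleGraph V} [DecidableRel G.Adj] {k : ℕ}

theorem adjSpectrum_subset_of_isPeriodic (hk : 0 < k) (hG : G.IsRegularOfDegree k)
    (hint : IsIntegralGraph G) (hper : IsPeriodic G) :
    adjSpectrum G ⊆ {(k : ℂ), -(k : ℂ), (k : ℂ) / 2, -((k : ℂ) / 2), 0} := by
  intro l hl
  obtain ⟨n, rfl⟩ := hint l hl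
  -- An eigenvector `v` of `A` lifts to the eigenvector `d* v` of `U + U⁻¹`, nonzero as `d d* = 1`.
  obtain ⟨v, hv, hAv⟩ := mem_spectrum_iff_exists_mulVec_eq.1 hl
  obtain ⟨τ, hτ, hU, -⟩ := hper
  have hk' : (k : ℂ) ≠ 0 := by exact_mod_cast hk.ne'
  have hw : (boundaryMatrix G)ᴴ *ᵥ v ≠ 0 := by
    intro h
    have := congrArg (boundaryMatrix G *ᵥ ·) h
    simp only [mulVec_mulVec, boundaryMatrix_mul_conjTranspose hk hG, one_mulVec,
      mulVec_zero] at this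
    exact hv this
  have hWw : (timeEvolution G + inverseEvolution G) *ᵥ ((boundaryMatrix G)ᴴ *ᵥ v) =
      (2 * n / k : ℂ) • ((boundaryMatrix G)ᴴ *ᵥ v) := by
    rw [mulVec_mulVec, add_inverseEvolution_mul_conjTranspose hk hG, ← mulVec_mulVec,
      smul_mulVec, hAv, smul_smul, mulVec_smul]
    congr 1
    ring
  obtain ⟨z, hz, hx⟩ := exists_pow_eq_one_of_add_mulVec_eq_smul
    (timeEvolution_mul_inverseEvolution hk hG) hU hw hWw
  obtain ⟨m, hm, hm1, hm2⟩ := exists_int_of_eq_add_inv hτ hz (q := 2 * n / k) (by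
    rw [← hx]
    push_cast
    rfl)
  have hn : (n : ℂ) = m * k / 2 := by
    push_cast at hm
    rw [← hm]
    field_simp
  rw [hn]
  simp only [Set.mem_insert_iff, Set.mem_singleton_iff]
  interval_cases m
  · right; left; push_cast; ring
  · right; right; right; left; push_cast; ring
  · right; right; right; right; simp
  · right; right; left; push_cast; ring
  · left; push_cast; ring

/-! ### Walks of finite order -/

open scoped ComplexOrder in
theorem eq_zero_of_mul_self_eq_zero_of_normal {n : Type*} [Fintype n] {N : Matrix n n ℂ}
    (hN : Commute N Nᴴ) (h : N * N = 0) : N = 0 := by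
  rw [← conjTranspose_mul_self_eq_zero, ← conjTranspose_mul_self_eq_zero, conjTranspose_mul,
    conjTranspose_conjTranspose, mul_assoc, ← mul_assoc N, hN.eq,
    mul_assoc Nᴴ N N, h, mul_zero, mul_zero]

theorem eq_zero_of_pow_four_eq_zero_of_normal {n : Type*} [Fintype n] [DecidableEq n]
    {N : Matrix n n ℂ} (hN : Commute N Nᴴ) (h : N ^ 4 = 0) : N = 0 := by
  refine eq_zero_of_mul_self_eq_zero_of_normal hN (eq_zero_of_mul_self_eq_zero_of_normal ?_ ?_)
  · rw [conjTranspose_mul]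
    exact (hN.mul_left hN).mul_right (hN.mul_left hN)
  · rw [← h]
    noncomm_ring

/-- For `w = u + u⁻¹`, multiplying `w`, `w² - 1` and `w² - 4` by suitable powers of `u` gives
`u² + 1`, `u⁴ + u² + 1` and `(u² - 1)²`, all dividing powers of `u¹² - 1`. -/
theorem pow_twelve_sub_one_pow_four_eq_zero {R : Type*} [Ring R] {u v : R} (huv : u * v = 1)
    (hvu : v * u = 1) (h : (u + v) * ((u + v) ^ 2 - 1) *
      (((u + v) ^ 2 - 4) * ((u + v) ^ 2 - 4)) = 0) : (u ^ 12 - 1) ^ 4 = 0 := by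
  set w := u + v with hw
  have hwu : w * u = u ^ 2 + 1 := by rw [hw, add_mul, hvu, sq]
  have hc : Commute w u := by
    rw [commute_iff_eq, hwu, hw, mul_add, huv, sq]
  have hsq : w ^ 2 * u ^ 2 = (u ^ 2 + 1) ^ 2 := by rw [← hc.mul_pow, hwu]
  have hw2 : ∀ a : ℤ, Commute (w ^ 2 - (a : R)) u := fun a =>
    (hc.pow_left 2).sub_left (Int.cast_commute a u)
  have h1 : (w ^ 2 - 1) * u ^ 2 = u ^ 4 + u ^ 2 + 1 := by
    rw [sub_mul, hsq]
    noncomm_ring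
  have h4 : (w ^ 2 - 4) * u ^ 2 = (u ^ 2 - 1) ^ 2 := by
    rw [sub_mul, hsq]
    noncomm_ring
  have hc1 : Commute (w ^ 2 - 1) u := by simpa using hw2 1
  have hc4 : Commute (w ^ 2 - 4) u := by simpa using hw2 4
  have hf : (u ^ 2 + 1) * (u ^ 4 + u ^ 2 + 1) * ((u ^ 2 - 1) ^ 2 * (u ^ 2 - 1) ^ 2) = 0 := by
    have hc44 : Commute ((w ^ 2 - 4) * (w ^ 2 - 4)) u := hc4.mul_left hc4
    have hcu : Commute (u * u ^ 2) ((w ^ 2 - 4) * (w ^ 2 - 4)) :=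
      (hc44.mul_right (hc44.pow_right 2)).symm
    rw [← hwu, ← h1, ← h4, hc1.symm.mul_mul_mul_comm, (hc4.pow_right 2).symm.mul_mul_mul_comm,
      hcu.mul_mul_mul_comm, h, zero_mul]
  have hdvd : (X ^ 2 + 1) * (X ^ 4 + X ^ 2 + 1) * ((X ^ 2 - 1) ^ 2 * (X ^ 2 - 1) ^ 2) *
      ((X ^ 2 + 1) ^ 3 * (X ^ 4 + X ^ 2 + 1) ^ 3 * (X ^ 4 - X ^ 2 + 1) ^ 4) =
      ((X ^ 12 - 1) ^ 4 : ℤ[X]) := by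
    ring
  have := congrArg (aeval u) hdvd
  simp only [map_mul, map_add, map_sub, map_pow, aeval_X, map_one] at this
  rw [← this, hf, zero_mul]

theorem four_smul_one {n : Type*} [Fintype n] [DecidableEq n] :
    (4 : ℂ) • (1 : Matrix n n ℂ) = 4 := by
  rw [← Algebra.algebraMap_eq_smul_one]
  exact map_ofNat (algebraMap ℂ (Matrix n n ℂ)) 4

/-- If all eigenvalues of the adjacency matrix lie in `{±k, ±k/2, 0}`, then those of the transition
matrix are cosines of multiples of `π/6`, and the walk has order dividing twelve. -/
theorem timeEvolution_pow_twelve (hk : 0 < k) (hG : G.IsRegularOfDegree k)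
    (hA : aeval (G.adjMatrix ℂ)
      (X * (X ^ 2 - C ((k : ℂ) ^ 2 / 4)) * (X ^ 2 - C ((k : ℂ) ^ 2))) = 0) :
    timeEvolution G ^ 12 = 1 := by
  have hk' : (k : ℂ) ≠ 0 := by exact_mod_cast hk.ne'
  have hUV := timeEvolution_mul_inverseEvolution hk hG
  have hVU : inverseEvolution G * timeEvolution G = 1 := mul_eq_one_comm.1 hUV
  set U := timeEvolution G with hU
  set U' := inverseEvolution G with hU'
  set D := (boundaryMatrix G)ᴴ with hD
  set S := shiftMatrix G with hS
  set M := (2 / k : ℂ) • G.adjMatrix ℂ with hM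
  have hSS : S * S = 1 := shiftMatrix_mul_self
  have hWD : (U + U') * D = D * M := add_inverseEvolution_mul_conjTranspose hk hG
  have hSU : S * U = U' * S := by
    rw [hU, hU', timeEvolution, inverseEvolution, ← mul_assoc, hSS, one_mul, mul_assoc, hSS,
      mul_one]
  have hUS : U * S = S * U' := by
    rw [← one_mul (U * S), ← hSS, mul_assoc, ← mul_assoc S U, hSU, mul_assoc, hSS, mul_one]
  have hWS : Commute (U + U') S := by
    rw [commute_iff_eq, add_mul, mul_add, hUS, hSU, add_comm]
  have hW : U + U' = (2 : ℂ) • (S * D * boundaryMatrix G) + (2 : ℂ) • (D * boundaryMatrix G * S) -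
      (2 : ℂ) • S := by
    rw [hU, hU', timeEvolution, inverseEvolution, ← hS, ← hD]
    simp only [Matrix.sub_mul, Matrix.mul_sub, Matrix.mul_smul, Matrix.smul_mul,
      Matrix.mul_assoc, Matrix.mul_one, Matrix.one_mul]
    module
  set W := U + U' with hWdef
  have hM0 : M * (M ^ 2 - 1) * (M ^ 2 - 4) = 0 := by
    have h1 : M ^ 2 - 1 = (2 / k : ℂ) ^ 2 • ((G.adjMatrix ℂ) ^ 2 -
        algebraMap ℂ _ ((k : ℂ) ^ 2 / 4)) := by
      have : (2 / k : ℂ) ^ 2 * (k ^ 2 / 4) = 1 := by field_simp; norm_num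
      rw [hM, _root_.smul_pow, smul_sub, Algebra.algebraMap_eq_smul_one, smul_smul, this, one_smul]
    have h2 : M ^ 2 - 4 = (2 / k : ℂ) ^ 2 • ((G.adjMatrix ℂ) ^ 2 -
        algebraMap ℂ _ ((k : ℂ) ^ 2)) := by
      have : (2 / k : ℂ) ^ 2 * k ^ 2 = 4 := by field_simp; norm_num
      rw [hM, _root_.smul_pow, smul_sub, Algebra.algebraMap_eq_smul_one, smul_smul, this,
        four_smul_one]
    rw [h1, h2, hM]
    simp only [map_mul, map_sub, map_pow, aeval_X, aeval_C] at hA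
    simp only [map_pow]
    simp only [smul_mul_assoc, mul_smul_comm, hA, smul_zero]
  set Z := W * (W ^ 2 - 1) * (W ^ 2 - 4) with hZ
  have hW2D : ∀ c : ℂ, (W ^ 2 - c • 1) * D = D * (M ^ 2 - c • 1) := by
    intro c
    rw [Matrix.sub_mul, Matrix.mul_sub, sq, sq, Matrix.mul_assoc, hWD, ← Matrix.mul_assoc, hWD]
    simp [Matrix.mul_assoc]
  have hZD : Z * D = 0 := by
    have h1 := hW2D 1
    have h2 := hW2D 4
    rw [four_smul_one, four_smul_one] at h2
    rw [one_smul, one_smul] at h1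
    rw [hZ, Matrix.mul_assoc, h2, ← Matrix.mul_assoc, Matrix.mul_assoc W, h1,
      ← Matrix.mul_assoc W, hWD, Matrix.mul_assoc, Matrix.mul_assoc, ← Matrix.mul_assoc M, hM0,
      Matrix.mul_zero]
  have hZS : Commute Z S :=
    (hWS.mul_left ((hWS.pow_left 2).sub_left (Commute.one_left S))).mul_left
      ((hWS.pow_left 2).sub_left (Commute.ofNat_left 4 S))
  -- `Z` kills `D = d*` and commutes with `S`, so only the last term of `W` in `hW` survives.
  have hZW : Z * W = -(2 : ℂ) • (Z * S) := by
    have h1 : Z * (S * D * boundaryMatrix G) = 0 := by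
      rw [← Matrix.mul_assoc, ← Matrix.mul_assoc, hZS.eq, Matrix.mul_assoc S, hZD,
        Matrix.mul_zero, Matrix.zero_mul]
    have h2 : Z * (D * boundaryMatrix G * S) = 0 := by
      rw [← Matrix.mul_assoc, ← Matrix.mul_assoc, hZD, Matrix.zero_mul, Matrix.zero_mul]
    rw [hW, Matrix.mul_sub, Matrix.mul_add, Matrix.mul_smul, Matrix.mul_smul, Matrix.mul_smul,
      h1, h2]
    module
  have hZW2 : Z * (W ^ 2 - 4) = 0 := by
    rw [mul_sub, sq, ← mul_assoc, hZW, smul_mul_assoc, mul_assoc, ← hWS.eq, ← mul_assoc, hZW,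
      smul_mul_assoc, mul_assoc, hSS, smul_smul, ← four_smul_one, mul_smul_comm, mul_one]
    module
  -- The relation `Z (W² - 4) = 0` has `U ± 1` as repeated factors; normality of `U` removes them.
  have hN : Commute (U ^ 12 - 1) (U ^ 12 - 1)ᴴ := by
    rw [conjTranspose_sub, conjTranspose_pow, conjTranspose_timeEvolution, conjTranspose_one]
    have : Commute U U' := hUV.trans hVU.symm
    exact ((this.pow_pow 12 12).sub_left (Commute.one_left _)).sub_right (Commute.one_right _)
  refine sub_eq_zero.1 (eq_zero_of_pow_four_eq_zero_of_normal hN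
    (pow_twelve_sub_one_pow_four_eq_zero hUV hVU ?_))
  rw [← hWdef, ← mul_assoc, ← hZ, hZW2]

theorem isPeriodic_of_pow_eq_one {τ : ℕ} (hτ : 0 < τ) (h : timeEvolution G ^ τ = 1) :
    IsPeriodic G := by
  classical
  have hex : ∃ τ, 0 < τ ∧ timeEvolution G ^ τ = 1 := ⟨τ, hτ, h⟩
  exact ⟨Nat.find hex, (Nat.find_spec hex).1, (Nat.find_spec hex).2,
    fun j hj hlt hj1 => Nat.find_min hex hlt ⟨hj, hj1⟩⟩

/-- An eigenvalue in `{±k, ±k/2, 0}` is rational, hence an integer since it is an algebraic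
integer. -/
theorem isIntegralGraph_of_adjSpectrum_subset
    (h : adjSpectrum G ⊆ {(k : ℂ), -(k : ℂ), (k : ℂ) / 2, -((k : ℂ) / 2), 0}) :
    IsIntegralGraph G := by
  intro z hz
  obtain ⟨q, hq⟩ : ∃ q : ℚ, z = algebraMap ℚ ℂ q := by
    rcases h hz with h | h | h | h | h
    · exact ⟨k, by simp [h]⟩
    · exact ⟨-k, by simp [h]⟩
    · exact ⟨k / 2, by simp [h]⟩
    · exact ⟨-(k / 2), by simp [h]⟩
    · exact ⟨0, by simpa using h⟩
  have hint := isIntegral_of_mem_adjSpectrum hz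
  rw [hq, isIntegral_algebraMap_iff (algebraMap ℚ ℂ).injective,
    IsIntegrallyClosed.isIntegral_iff] at hint
  obtain ⟨m, rfl⟩ := hint
  exact ⟨m, by simp [hq]⟩

theorem adjSpectrum_eq_iff_spectrum_eq {s : Set ℝ} :
    adjSpectrum G = (fun x : ℝ => (x : ℂ)) '' s ↔ spectrum ℝ (G.adjMatrix ℝ) = s := by
  rw [adjSpectrum_eq_image, Complex.ofReal_injective.image_injective.eq_iff]

theorem adjSpectrum_subset_iff :
    adjSpectrum G ⊆ {(k : ℂ), -(k : ℂ), (k : ℂ) / 2, -((k : ℂ) / 2), 0} ↔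
      spectrum ℝ (G.adjMatrix ℝ) ⊆ {(k : ℝ), -(k : ℝ), (k : ℝ) / 2, -((k : ℝ) / 2), 0} := by
  rw [adjSpectrum_eq_image, ← Set.image_subset_image_iff Complex.ofReal_injective]
  simp [Set.image_insert_eq]

theorem isPeriodic_of_adjSpectrum_subset (hG : G.IsRegularOfDegree k)
    (h : adjSpectrum G ⊆ {(k : ℂ), -(k : ℂ), (k : ℂ) / 2, -((k : ℂ) / 2), 0}) :
    IsPeriodic G := by
  rcases Nat.eq_zero_or_pos k with rfl | hk
  · have : IsEmpty G.Dart := by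
      rw [← Fintype.card_eq_zero_iff, G.dart_card_eq_sum_degrees]
      exact Finset.sum_eq_zero fun v _ => hG v
    exact isPeriodic_of_pow_eq_one one_pos (Subsingleton.elim _ _)
  · refine isPeriodic_of_pow_eq_one (τ := 12) (by norm_num) (timeEvolution_pow_twelve hk hG ?_)
    have hA := aeval_eq_zero_of_isHermitian (isHermitian_adjMatrix G)
      (X * (X ^ 2 - C ((k : ℝ) ^ 2 / 4)) * (X ^ 2 - C ((k : ℝ) ^ 2))) (by
        intro x hx
        simp only [eval_mul, eval_sub, eval_pow, eval_X, eval_C]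
        rcases adjSpectrum_subset_iff.1 h hx with rfl | rfl | rfl | rfl | rfl <;> ring)
    have hmap : ∀ c : ℝ, (algebraMap ℝ ℂ).mapMatrix (algebraMap ℝ (Matrix V V ℝ) c) =
        algebraMap ℂ (Matrix V V ℂ) c := by
      intro c
      ext i j
      by_cases hij : i = j <;> simp [algebraMap_matrix_apply, hij]
    have hA' := congrArg (algebraMap ℝ ℂ).mapMatrix hA
    simp only [map_mul, map_sub, map_pow, aeval_X, aeval_C, map_zero, hmap] at hA' ⊢
    rw [RingHom.mapMatrix_apply, map_adjMatrix_ofReal] at hA'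
    simpa using hA'

end

open SimpleGraph

section

/-! ### Complete equipartite graphs -/

/-- A complete multipartite graph that is regular of degree `k` on `k + t` vertices has all its
parts of size `t`. -/
theorem nonempty_iso_completeEquipartiteGraph {V : Type*} [Fintype V] {G : SimpleGraph V}
    [DecidableRel G.Adj] (h : G.IsCompleteMultipartite) {k t r : ℕ} (ht : 0 < t)
    (hG : G.IsRegularOfDegree k) (hcard : Fintype.card V = k + t) (hr : r * t = k + t) :
    Nonempty (G ≃g completeEquipartiteGraph r t) := by
  classical
  let f : V → Quotient h.setoid := Quotient.mk h.setoid
  have hf : ∀ v w, f v = f w ↔ ¬ G.Adj v w := fun v w => Quotient.eq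
  have hfib : ∀ q, Fintype.card {x // f x = q} = t := by
    intro q
    obtain ⟨v, rfl⟩ := Quotient.exists_rep q
    have : (Finset.univ.filter fun x => f x = f v) = (G.neighborFinset v)ᶜ := by
      ext x
      simp [hf, G.adj_comm]
    change Fintype.card {x // f x = f v} = t
    rw [Fintype.card_subtype, this, Finset.card_compl,
      G.card_neighborFinset_eq_degree, hG.degree_eq, hcard]
    omega
  let e₁ : V ≃ Quotient h.setoid × Fin t :=
    (Equiv.sigmaFiberEquiv f).symm.trans
      ((Equiv.sigmaCongrRight fun q => Fintype.equivFinOfCardEq (hfib q)).trans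
        (Equiv.sigmaEquivProd _ _))
  have he₁ : ∀ v, (e₁ v).1 = f v := fun v => rfl
  have hQ : Fintype.card (Quotient h.setoid) = r := by
    have := Fintype.card_congr e₁
    rw [Fintype.card_prod, Fintype.card_fin, hcard, ← hr] at this
    exact (Nat.eq_of_mul_eq_mul_right ht this).symm
  let e₂ := Fintype.equivFinOfCardEq hQ
  refine ⟨⟨e₁.trans (e₂.prodCongr (Equiv.refl _)), fun {v w} => ?_⟩⟩
  rw [completeEquipartiteGraph_adj]
  change e₂ (e₁ v).1 ≠ e₂ (e₁ w).1 ↔ _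
  rw [he₁, he₁, e₂.injective.ne_iff, Ne, hf, not_not]

/-- The complete bipartite graph with parts of equal size, as a complete equipartite graph. -/
def completeEquipartiteGraphTwoIso (k : ℕ) :
    completeEquipartiteGraph 2 k ≃g completeBipartiteGraph (Fin k) (Fin k) where
  toFun x := if x.1 = 0 then Sum.inl x.2 else Sum.inr x.2
  invFun := Sum.elim (fun a => (0, a)) (fun a => (1, a))
  left_inv := by
    rintro ⟨i, a⟩
    fin_cases i <;> simp
  right_inv := by
    rintro (a | a) <;> simp
  map_rel_iff' := by
    rintro ⟨i, a⟩ ⟨j, b⟩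
    fin_cases i <;> fin_cases j <;> simp

theorem isRegularOfDegree_completeEquipartiteGraph (r t : ℕ) :
    (completeEquipartiteGraph r t).IsRegularOfDegree ((r - 1) * t) := fun v =>
  degree_completeEquipartiteGraph v

/-- With `S` the sum of the entries of an eigenvector and `S i` its sum over the `i`-th part, the
eigenvalue equation at a vertex of that part reads `x v = S - S i`; summing it over the parts and
over all vertices leaves three possible eigenvalues. -/
theorem spectrum_completeEquipartiteGraph {r t : ℕ} {x : ℝ}
    (hx : x ∈ spectrum ℝ ((completeEquipartiteGraph r t).adjMatrix ℝ)) :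
    x = (r - 1) * t ∨ x = -t ∨ x = 0 := by
  obtain ⟨v, hv, hAv⟩ := mem_spectrum_iff_exists_mulVec_eq.1 hx
  let p : Fin r → ℝ := fun i => ∑ a, v (i, a)
  have h1 : ∀ i a, x * v (i, a) = (∑ j, p j) - p i := by
    intro i a
    have := congrFun hAv (i, a)
    rw [adjMatrix_mulVec_apply, neighborFinset_completeEquipartiteGraph, Finset.sum_product,
      Pi.smul_apply, smul_eq_mul] at this
    rw [← this, eq_sub_iff_add_eq, add_comm, ← Finset.sum_compl_add_sum {i}]
    simp [p, add_comm]
  have h2 : ∀ i, x * p i = t * ((∑ j, p j) - p i) := by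
    intro i
    rw [show p i = ∑ a, v (i, a) from rfl, Finset.mul_sum, Finset.sum_congr rfl fun a _ => h1 i a,
      Finset.sum_const, Finset.card_univ, Fintype.card_fin, nsmul_eq_mul]
  have h3 : x * (∑ j, p j) = (r - 1) * t * ∑ j, p j := by
    rw [Finset.mul_sum, Finset.sum_congr rfl fun i _ => h2 i, ← Finset.mul_sum,
      Finset.sum_sub_distrib]
    simp
    ring
  by_cases hS : ∑ j, p j = 0
  · simp only [hS, zero_sub] at h1 h2
    by_cases hp : ∀ i, p i = 0
    · right; right
      by_contra hx0
      refine hv (funext fun ⟨i, a⟩ => ?_)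
      have := h1 i a
      rw [hp, neg_zero] at this
      exact (mul_eq_zero.1 this).resolve_left hx0
    · right; left
      push Not at hp
      obtain ⟨i, hi⟩ := hp
      exact mul_right_cancel₀ hi (by linarith [h2 i])
  · exact Or.inl (mul_right_cancel₀ hS h3)

/-! ### The hexagon -/

theorem spectrum_cycleGraph_six {x : ℝ} (hx : x ∈ spectrum ℝ ((cycleGraph 6).adjMatrix ℝ)) :
    x = 2 ∨ x = -2 ∨ x = 1 ∨ x = -1 := by
  obtain ⟨v, hv, hAv⟩ := mem_spectrum_iff_exists_mulVec_eq.1 hx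
  have hne : ∀ i : Fin 6, i - 1 ≠ i + 1 := by decide
  have h : ∀ i : Fin 6, v (i - 1) + v (i + 1) = x * v i := by
    intro i
    have := congrFun hAv i
    rw [adjMatrix_mulVec_apply, cycleGraph_neighborFinset, Finset.sum_pair (hne i)]
      at this
    simpa using this
  have hq : ∀ i : Fin 6, (x - 2) * ((x + 2) * ((x - 1) * (x + 1))) * v i = 0 := by
    have key : ∀ a0 a1 a2 a3 a4 a5 : ℝ, a5 + a1 = x * a0 → a0 + a2 = x * a1 → a1 + a3 = x * a2 →
        a2 + a4 = x * a3 → a3 + a5 = x * a4 → a4 + a0 = x * a5 →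
        (x - 2) * ((x + 2) * ((x - 1) * (x + 1))) * a0 = 0 := by
      intro a0 a1 a2 a3 a4 a5 e0 e1 e2 e3 e4 e5
      -- `A²` adds to `a0` the sum over the even vertices, and multiplies that sum by `4`.
      have hE : (x ^ 2 - 1) * a0 = a0 + a2 + a4 := by linear_combination -x * e0 - e1 - e5
      have hE4 : (x ^ 2 - 4) * (a0 + a2 + a4) = 0 := by
        linear_combination -x * (e0 + e2 + e4) - 2 * (e1 + e3 + e5)
      linear_combination (x ^ 2 - 4) * hE + hE4
    intro i
    fin_cases i
    · exact key _ _ _ _ _ _ (h 0) (h 1) (h 2) (h 3) (h 4) (h 5)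
    · exact key _ _ _ _ _ _ (h 1) (h 2) (h 3) (h 4) (h 5) (h 0)
    · exact key _ _ _ _ _ _ (h 2) (h 3) (h 4) (h 5) (h 0) (h 1)
    · exact key _ _ _ _ _ _ (h 3) (h 4) (h 5) (h 0) (h 1) (h 2)
    · exact key _ _ _ _ _ _ (h 4) (h 5) (h 0) (h 1) (h 2) (h 3)
    · exact key _ _ _ _ _ _ (h 5) (h 0) (h 1) (h 2) (h 3) (h 4)
  obtain ⟨i, hi⟩ := Function.ne_iff.1 hv
  have := (mul_eq_zero.1 (hq i)).resolve_right hi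
  simp only [mul_eq_zero, sub_eq_zero, add_eq_zero_iff_eq_neg] at this
  exact this

theorem exists_other_neighbor {V : Type*} [Fintype V] {G : SimpleGraph V}
    [DecidableRel G.Adj] (hG : G.IsRegularOfDegree 2) {v a : V} (h : G.Adj v a) :
    ∃ b, b ≠ a ∧ ∀ w, G.Adj v w ↔ w = a ∨ w = b := by
  classical
  obtain ⟨y, z, hyz, hN⟩ := Finset.card_eq_two.1
    ((G.card_neighborFinset_eq_degree v).trans (hG v))
  have hw : ∀ w, G.Adj v w ↔ w = y ∨ w = z := fun w => by
    rw [← G.mem_neighborFinset, hN]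
    simp
  rcases (hw a).1 h with rfl | rfl
  · exact ⟨z, hyz.symm, hw⟩
  · exact ⟨y, hyz, fun w => by rw [hw, or_comm]⟩

/-- A bipartite `2`-regular graph on six vertices without a `4`-cycle is a hexagon. The bipartition
is given by the sign of a nowhere vanishing function `c`. -/
theorem nonempty_iso_cycleGraph_six {V : Type*} [Fintype V] {G : SimpleGraph V}
    [DecidableRel G.Adj] (hG : G.IsRegularOfDegree 2) (hcard : Fintype.card V = 6) (c : V → ℝ)
    (hc0 : ∀ v, c v ≠ 0) (hc : ∀ v w, G.Adj v w → c v = -c w)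
    (hcommon : ∀ v w a b, v ≠ w → G.Adj v a → G.Adj w a → G.Adj v b → G.Adj w b → a = b) :
    Nonempty (G ≃g cycleGraph 6) := by
  classical
  have : Nonempty V := Fintype.card_pos_iff.1 (by omega)
  obtain ⟨x0⟩ := this
  -- Walk from `x0` in both directions, to `x1, x2, x3` and to `x5, x4`; the absence of `4`-cycles
  -- and the bipartition keep these vertices distinct, so that they exhaust the graph.
  obtain ⟨x1, h01⟩ := (G.degree_pos_iff_exists_adj x0).1 (by rw [hG.degree_eq]; norm_num)
  obtain ⟨x5, h51, n0⟩ := exists_other_neighbor hG h01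
  obtain ⟨x2, h20, n1⟩ := exists_other_neighbor hG h01.symm
  have h05 : G.Adj x0 x5 := (n0 _).2 (Or.inr rfl)
  obtain ⟨x4, h40, n5⟩ := exists_other_neighbor hG h05.symm
  have h12 : G.Adj x1 x2 := (n1 _).2 (Or.inr rfl)
  have h54 : G.Adj x5 x4 := (n5 _).2 (Or.inr rfl)
  have h24 : x2 ≠ x4 := by
    rintro rfl
    exact h20 (hcommon _ _ _ _ h51 h54 h12 h05.symm h01.symm)
  obtain ⟨x3, h31, n2⟩ := exists_other_neighbor hG h12.symm
  have h23 : G.Adj x2 x3 := (n2 _).2 (Or.inr rfl)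
  have h35 : x3 ≠ x5 := by
    rintro rfl
    rcases (n5 x2).1 h23.symm with h | h
    · exact h20 h
    · exact h24 h
  have hne : ∀ v w, c v = -c w → v ≠ w := by
    rintro v _ h rfl
    exact hc0 v (by linarith)
  have c1 := hc _ _ h01
  have c5 := hc _ _ h05
  have c2 := hc _ _ h12
  have c4 := hc _ _ h54
  have c3 := hc _ _ h23
  have d03 := hne x0 x3 (by linarith)
  have d25 := hne x2 x5 (by linarith)
  have d43 := hne x4 x3 (by linarith)
  have d41 := hne x4 x1 (by linarith)
  let f : Fin 6 → V := ![x0, x1, x2, x3, x4, x5]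
  have hinj : Function.Injective f := by
    have d01 := h01.ne
    have d05 := h05.ne
    have d12 := h12.ne
    have d54 := h54.ne
    have d23 := h23.ne
    intro i j hij
    fin_cases i <;> fin_cases j <;>
      first
        | rfl
        | exact absurd hij (by assumption)
        | exact absurd hij.symm (by assumption)
  have hbij : Function.Bijective f :=
    (Fintype.bijective_iff_injective_and_card f).2 ⟨hinj, by simp [hcard]⟩
  obtain ⟨y, hy5, n4⟩ := exists_other_neighbor hG h54.symm
  have h4y : G.Adj x4 y := (n4 _).2 (Or.inr rfl)
  have hy3 : y = x3 := by
    have cy := hc _ _ h4y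
    have hy0 := hne y x0 (by linarith)
    have hy2 := hne y x2 (by linarith)
    have hy4 := h4y.ne'
    have hy1 : y ≠ x1 := by
      rintro rfl
      rcases (n1 x4).1 h4y.symm with h | h
      · exact h40 h
      · exact h24 h.symm
    obtain ⟨i, hi⟩ := hbij.surjective y
    fin_cases i <;>
      first
        | exact hi.symm
        | exact absurd hi.symm (by assumption)
  subst hy3
  obtain ⟨z, hz2, n3⟩ := exists_other_neighbor hG h23.symm
  have hz4 : z = x4 := (((n3 x4).1 h4y.symm).resolve_left h24.symm).symm
  subst hz4
  have hadj : ∀ i w, G.Adj (f i) w ↔ w = f (i - 1) ∨ w = f (i + 1) := by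
    intro i w
    fin_cases i
    · exact (n0 w).trans or_comm
    · exact n1 w
    · exact n2 w
    · exact n3 w
    · exact (n4 w).trans or_comm
    · exact (n5 w).trans or_comm
  refine ⟨(RelIso.symm ⟨Equiv.ofBijective f hbij, fun {i j} => ?_⟩ : G ≃g cycleGraph 6)⟩
  rw [Equiv.ofBijective_apply, Equiv.ofBijective_apply, hadj, hinj.eq_iff, hinj.eq_iff]
  clear * -
  revert i j
  decide

end

section

/-! ### Eigenvectors for the extreme eigenvalues of a connected regular graph -/

theorem eq_of_forall_adj_eq {V α : Type*} {G : SimpleGraph V} (hG : G.Connected) {f : V → α}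
    (h : ∀ u w, G.Adj u w → f u = f w) (u w : V) : f u = f w := by
  obtain ⟨p⟩ := hG.preconnected u w
  induction p with
  | nil => rfl
  | cons huv _ ih => exact (h _ _ huv).trans ih

variable {V : Type*} [Fintype V] [DecidableEq V] {G : SimpleGraph V} [DecidableRel G.Adj] {k : ℕ}

omit [DecidableEq V] in
theorem sum_adjMatrix_apply (hG : G.IsRegularOfDegree k) (u : V) :
    ∑ w, G.adjMatrix ℝ u w = k := by
  simp [adjMatrix_apply, ← hG.degree_eq u, ← card_neighborFinset_eq_degree,
    neighborFinset_eq_filter]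

omit [DecidableEq V] in
theorem adjMatrix_mulVec_one (hG : G.IsRegularOfDegree k) :
    G.adjMatrix ℝ *ᵥ (fun _ => 1) = (k : ℝ) • fun _ => 1 :=
  funext fun u => by simpa using hG u

omit [DecidableEq V] in
/-- For `ε = ±1`, an eigenvector for the eigenvalue `ε k` satisfies `v u = ε v w` along each edge,
since the sum of `(v u - ε v w)²` over all arcs vanishes. -/
theorem eq_mul_of_adj_of_mulVec_eq (hG : G.IsRegularOfDegree k) {ε : ℝ} (hε : ε ^ 2 = 1)
    {v : V → ℝ} (hv : G.adjMatrix ℝ *ᵥ v = (ε * k) • v) {u w : V} (huw : G.Adj u w) :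
    v u = ε * v w := by
  have hsum : ∑ u, ∑ w, G.adjMatrix ℝ u w * (v u - ε * v w) ^ 2 = 0 := by
    have h1 : ∑ u, ∑ w, G.adjMatrix ℝ u w * v u ^ 2 = k * ∑ u, v u ^ 2 := by
      simp only [← Finset.sum_mul, sum_adjMatrix_apply hG, Finset.mul_sum]
    have h2 : ∑ u, ∑ w, G.adjMatrix ℝ u w * v w ^ 2 = k * ∑ u, v u ^ 2 := by
      rw [Finset.sum_comm, ← h1]
      refine Finset.sum_congr rfl fun x _ => Finset.sum_congr rfl fun y _ => ?_
      simp only [adjMatrix_apply, G.adj_comm]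
    have h3 : ∑ u, ∑ w, G.adjMatrix ℝ u w * (v u * v w) = ε * k * ∑ u, v u ^ 2 := by
      rw [Finset.mul_sum]
      refine Finset.sum_congr rfl fun x _ => ?_
      have := congrFun hv x
      simp only [mulVec, dotProduct, Pi.smul_apply, smul_eq_mul] at this
      calc _ = v x * ∑ w, G.adjMatrix ℝ x w * v w := by
            rw [Finset.mul_sum]
            exact Finset.sum_congr rfl fun y _ => by ring
        _ = _ := by
            rw [this]
            ring
    calc _ = ∑ u, ∑ w, G.adjMatrix ℝ u w * v u ^ 2 +
          ε ^ 2 * ∑ u, ∑ w, G.adjMatrix ℝ u w * v w ^ 2 -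
          2 * ε * ∑ u, ∑ w, G.adjMatrix ℝ u w * (v u * v w) := by
          simp only [Finset.mul_sum, ← Finset.sum_add_distrib, ← Finset.sum_sub_distrib]
          exact Finset.sum_congr rfl fun x _ => Finset.sum_congr rfl fun y _ => by ring
      _ = 0 := by
          rw [h1, h2, h3]
          linear_combination -(k * ∑ u, v u ^ 2) * hε
  have hnn : ∀ u w, 0 ≤ G.adjMatrix ℝ u w * (v u - ε * v w) ^ 2 := fun u w => by
    rw [adjMatrix_apply]
    split_ifs <;> positivity
  have h1 := (Finset.sum_eq_zero_iff_of_nonneg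
    fun u _ => Finset.sum_nonneg fun w _ => hnn u w).1 hsum u (Finset.mem_univ u)
  have h2 := (Finset.sum_eq_zero_iff_of_nonneg fun w _ => hnn u w).1 h1 w (Finset.mem_univ w)
  rw [adjMatrix_apply, if_pos huw, one_mul] at h2
  exact sub_eq_zero.1 (pow_eq_zero_iff two_ne_zero |>.1 h2)

theorem natCast_mem_spectrum [Nonempty V] (hG : G.IsRegularOfDegree k) :
    (k : ℝ) ∈ spectrum ℝ (G.adjMatrix ℝ) := by
  refine mem_spectrum_iff_exists_mulVec_eq.2 ⟨fun _ => 1, ?_, adjMatrix_mulVec_one hG⟩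
  obtain ⟨x⟩ := ‹Nonempty V›
  exact fun h => one_ne_zero (congrFun h x)

/-- If `-k` is an eigenvalue, its eigenvector encodes a bipartition by its signs. -/
theorem exists_bipartition (hconn : G.Connected) (hG : G.IsRegularOfDegree k)
    (hk : -(k : ℝ) ∈ spectrum ℝ (G.adjMatrix ℝ)) :
    ∃ c : V → ℝ, (∀ v, c v ≠ 0) ∧ ∀ u w, G.Adj u w → c u = -c w := by
  obtain ⟨c, hc, hAc⟩ := mem_spectrum_iff_exists_mulVec_eq.1 hk
  have hadj : ∀ u w, G.Adj u w → c u = -c w := fun u w h => by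
    rw [eq_mul_of_adj_of_mulVec_eq hG (ε := -1) (v := c) (by norm_num) (by rw [hAc]; simp) h,
      neg_one_mul]
  refine ⟨c, fun v hv => hc (funext fun u => ?_), hadj⟩
  have := eq_of_forall_adj_eq hconn (f := fun v => c v ^ 2)
    (fun u w h => by simp only [hadj u w h, neg_sq]) u v
  simpa [hv] using this

theorem neg_mem_spectrum_of_bipartition {c : V → ℝ} (hc0 : ∀ v, c v ≠ 0)
    (hc : ∀ u w, G.Adj u w → c u = -c w) {x : ℝ} (hx : x ∈ spectrum ℝ (G.adjMatrix ℝ)) :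
    -x ∈ spectrum ℝ (G.adjMatrix ℝ) := by
  obtain ⟨v, hv, hAv⟩ := mem_spectrum_iff_exists_mulVec_eq.1 hx
  refine mem_spectrum_iff_exists_mulVec_eq.2 ⟨fun u => c u * v u, fun h => hv ?_, ?_⟩
  · ext u
    exact (mul_eq_zero.1 (congrFun h u)).resolve_left (hc0 u)
  · ext u
    have h1 := congrFun hAv u
    simp only [adjMatrix_mulVec_apply, Pi.smul_apply, smul_eq_mul] at h1 ⊢
    calc _ = -c u * ∑ w ∈ G.neighborFinset u, v w := by
          rw [Finset.mul_sum]
          refine Finset.sum_congr rfl fun w hw => ?_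
          rw [hc u w ((G.mem_neighborFinset u w).1 hw), neg_neg]
      _ = _ := by
          rw [h1]
          ring

/-! ### Polynomials in the adjacency matrix with constant entries -/

theorem aeval_adjMatrix_mulVec_one (hG : G.IsRegularOfDegree k) (p : ℝ[X]) :
    aeval (G.adjMatrix ℝ) p *ᵥ (fun _ => 1) = fun _ => p.eval (k : ℝ) := by
  induction p using Polynomial.induction_on' with
  | add p q hp hq =>
    ext u
    simp [add_mulVec, hp, hq]
  | monomial n a =>
    have hpow : (G.adjMatrix ℝ) ^ n *ᵥ (fun _ => 1) = (k : ℝ) ^ n • fun _ => 1 := by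
      induction n with
      | zero => simp
      | succ n ih => rw [pow_succ, ← mulVec_mulVec, adjMatrix_mulVec_one hG, mulVec_smul, ih,
          smul_smul, pow_succ']
    rw [aeval_monomial, Algebra.algebraMap_eq_smul_one, smul_mul_assoc, one_mul, smul_mulVec, hpow]
    ext u
    simp

/-- A polynomial vanishing at all eigenvalues of a connected `k`-regular graph other than `k` turns
the adjacency matrix into a multiple of the all-ones matrix. -/
theorem exists_aeval_adjMatrix_apply_eq (hconn : G.Connected) (hG : G.IsRegularOfDegree k)
    (p : ℝ[X]) (hp : ∀ x ∈ spectrum ℝ (G.adjMatrix ℝ), x ≠ k → p.eval x = 0) :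
    ∃ c : ℝ, (∀ u v, aeval (G.adjMatrix ℝ) p u v = c) ∧ Fintype.card V * c = p.eval (k : ℝ) := by
  set A := G.adjMatrix ℝ with hA
  set M := aeval A p with hM
  have hzero : aeval A ((X - C (k : ℝ)) * p) = 0 := by
    refine aeval_eq_zero_of_isHermitian (isHermitian_adjMatrix G) _ fun x hx => ?_
    by_cases hxk : x = k
    · simp [hxk]
    · simp [hp x hx hxk]
  have hAM : A * M = (k : ℝ) • M := by
    have : aeval A ((X - C (k : ℝ)) * p) = A * M - (k : ℝ) • M := by
      rw [map_mul, map_sub, aeval_X, aeval_C, sub_mul, Algebra.algebraMap_eq_smul_one,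
        smul_mul_assoc, one_mul]
    exact sub_eq_zero.1 (this ▸ hzero)
  have hMA : A * Mᵀ = (k : ℝ) • Mᵀ := by
    have : aeval A (p * (X - C (k : ℝ))) = M * A - (k : ℝ) • M := by
      rw [map_mul, map_sub, aeval_X, aeval_C, mul_sub, Algebra.algebraMap_eq_smul_one,
        mul_smul_comm, mul_one]
    rw [mul_comm, this, sub_eq_zero] at hzero
    rw [← transpose_smul, ← hzero, transpose_mul, hA, transpose_adjMatrix]
  have hconst : ∀ N : Matrix V V ℝ, A * N = (k : ℝ) • N → ∀ u u' v, N u v = N u' v := by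
    intro N hN u u' v
    refine eq_of_forall_adj_eq hconn (f := fun u => N u v) (fun x y hxy => ?_) u u'
    have := eq_mul_of_adj_of_mulVec_eq hG (ε := 1) (by norm_num) (v := fun u => N u v) (by
      ext u
      have := congrFun (congrFun hN u) v
      rw [mul_apply] at this
      rw [one_mul]
      exact this) hxy
    simpa using this
  obtain ⟨x⟩ := hconn.nonempty
  have hc : ∀ u v, M u v = M x x := fun u v =>
    (hconst M hAM u x v).trans (hconst Mᵀ hMA v x x)
  refine ⟨M x x, hc, ?_⟩
  have := congrFun (aeval_adjMatrix_mulVec_one hG p) x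
  rw [← hA, ← hM] at this
  simpa [mulVec, dotProduct, hc] using this

theorem adjMatrix_sq_apply (u v : V) :
    (G.adjMatrix ℝ ^ 2) u v = (G.neighborFinset u ∩ G.neighborFinset v).card := by
  rw [sq, adjMatrix_mul_apply]
  simp only [adjMatrix_apply]
  rw [Finset.sum_boole, ← Finset.filter_mem_eq_inter]
  simp [G.adj_comm]

theorem adjMatrix_sq_apply_self (hG : G.IsRegularOfDegree k) (u : V) :
    (G.adjMatrix ℝ ^ 2) u u = k := by
  rw [adjMatrix_sq_apply, Finset.inter_self, card_neighborFinset_eq_degree, hG.degree_eq]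

/-! ### Classification by spectrum -/

/-- Here `A² + t A` has all entries equal to `k`, so that nonadjacent vertices have the same
neighbours. -/
theorem iso_completeEquipartiteGraph_of_spectrum_subset (hconn : G.Connected) (hk : 0 < k)
    (hG : G.IsRegularOfDegree k) {r t : ℕ} (ht : 0 < t) (hr : r * t = k + t)
    (h : spectrum ℝ (G.adjMatrix ℝ) ⊆ {(k : ℝ), -(t : ℝ), 0}) :
    Nonempty (G ≃g completeEquipartiteGraph r t) := by
  obtain ⟨c, hc, hn⟩ := exists_aeval_adjMatrix_apply_eq hconn hG (X ^ 2 + C (t : ℝ) * X) (by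
    intro x hx hxk
    rcases h hx with rfl | rfl | rfl
    · exact absurd rfl hxk
    · simp only [eval_add, eval_pow, eval_X, eval_mul, eval_C]; ring
    · simp)
  simp only [map_add, map_mul, map_pow, aeval_X, aeval_C, Algebra.algebraMap_eq_smul_one,
    smul_mul_assoc, one_mul, Matrix.add_apply, Matrix.smul_apply, smul_eq_mul] at hc
  obtain ⟨x⟩ := hconn.nonempty
  have hck : c = k := by
    rw [← hc x x, adjMatrix_sq_apply_self hG]
    simp
  have hcard : Fintype.card V = k + t := by
    have hk' : (k : ℝ) ≠ 0 := by exact_mod_cast hk.ne'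
    have : (Fintype.card V : ℝ) = k + t := by
      refine mul_right_cancel₀ hk' ?_
      rw [hck] at hn
      rw [hn]
      simp only [eval_add, eval_pow, eval_X, eval_mul, eval_C]
      ring
    exact_mod_cast this
  refine nonempty_iso_completeEquipartiteGraph ⟨fun u v w huv hvw huw => hvw ?_⟩ ht hG hcard hr
  have h2 := hc u v
  rw [adjMatrix_apply, if_neg huv, mul_zero, add_zero, adjMatrix_sq_apply, hck] at h2
  have h3 : G.neighborFinset u ∩ G.neighborFinset v = G.neighborFinset u := by
    refine Finset.eq_of_subset_of_card_le Finset.inter_subset_left ?_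
    rw [card_neighborFinset_eq_degree, hG.degree_eq]
    exact_mod_cast h2.ge
  have h4 : w ∈ G.neighborFinset u ∩ G.neighborFinset v := by
    rw [h3]
    exact (G.mem_neighborFinset u w).2 huw
  exact (G.mem_neighborFinset v w).1 (Finset.mem_inter.1 h4).2

/-- The eigenvalues of the adjacency matrix sum to its trace, which is zero. -/
theorem exists_neg_mem_spectrum (hk : 0 < k)
    (hkmem : (k : ℝ) ∈ spectrum ℝ (G.adjMatrix ℝ)) :
    ∃ x ∈ spectrum ℝ (G.adjMatrix ℝ), x < 0 := by
  by_contra! hnn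
  have hA := isHermitian_adjMatrix G
  have htr := hA.trace_eq_sum_eigenvalues
  rw [trace_adjMatrix] at htr
  have h0 := (Finset.sum_eq_zero_iff_of_nonneg fun i _ => by
    simpa using hnn _ (hA.eigenvalues_mem_spectrum_real i)).1 htr.symm
  rw [hA.spectrum_real_eq_range_eigenvalues] at hkmem
  obtain ⟨i, hi⟩ := hkmem
  have := h0 i (Finset.mem_univ i)
  simp only [RCLike.ofReal_real_eq_id, id_eq, hi, Nat.cast_eq_zero] at this
  omega

/-- If `±k/2` are the only eigenvalues besides `k`, then `A² - (k²/4) I` is a multiple of the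
all-ones matrix, which forces `G` to be a triangle; but `k/2 = 1` is not an eigenvalue of the
triangle. -/
theorem not_spectrum_subset_of_half_mem (hconn : G.Connected) (hG : G.IsRegularOfDegree k)
    {m : ℕ} (hm : k = 2 * m) (hm0 : 0 < m) (hmem : (m : ℝ) ∈ spectrum ℝ (G.adjMatrix ℝ)) :
    ¬ spectrum ℝ (G.adjMatrix ℝ) ⊆ {(k : ℝ), (m : ℝ), -(m : ℝ)} := by
  intro h
  obtain ⟨c, hc, hn⟩ := exists_aeval_adjMatrix_apply_eq hconn hG (X ^ 2 - C ((m : ℝ) ^ 2)) (by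
    intro x hx hxk
    rcases h hx with rfl | rfl | rfl
    · exact absurd rfl hxk
    · simp
    · simp)
  obtain ⟨x⟩ := hconn.nonempty
  have hcx : c = k - (m : ℝ) ^ 2 := by
    have := hc x x
    simp only [map_sub, map_pow, aeval_X, aeval_C, Algebra.algebraMap_eq_smul_one,
      _root_.smul_pow, one_pow, Matrix.sub_apply, Matrix.smul_apply, one_apply_eq, smul_eq_mul,
      mul_one, adjMatrix_sq_apply_self hG] at this
    exact this.symm
  have hk' : (k : ℝ) = 2 * m := by exact_mod_cast hm
  have hm' : (0 : ℝ) < m := by exact_mod_cast hm0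
  rw [hcx] at hn
  simp only [eval_sub, eval_pow, eval_X, eval_C, hk'] at hn
  have hm1 : m = 1 := by
    have hpos : (0 : ℝ) < Fintype.card V * (2 * m - m ^ 2) := by
      rw [hn]
      nlinarith
    have h2 : (0 : ℝ) < 2 * m - m ^ 2 := pos_of_mul_pos_right hpos (by positivity)
    have h3 : (m : ℝ) < 2 := by nlinarith
    have : m < 2 := by exact_mod_cast h3
    omega
  subst hm1
  have hcard : Fintype.card V = 3 := by
    have : (Fintype.card V : ℝ) = 3 := by
      push_cast at hn
      linarith
    exact_mod_cast this
  obtain ⟨e⟩ := nonempty_iso_completeEquipartiteGraph (G := G) (r := 3) (t := 1)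
    ⟨fun u v w huv hvw => by
      have huniv : ∀ a, G.IsUniversal a := fun a =>
        (G.degree_eq_card_sub_one a).1 (by rw [hG.degree_eq, hcard, hm])
      have h1 : u = v := by
        by_contra hne
        exact huv (huniv u hne)
      rwa [h1]⟩ one_pos hG (by omega) (by omega)
  rw [spectrum_adjMatrix_eq_of_iso e] at hmem
  have := spectrum_completeEquipartiteGraph hmem
  norm_num at this

/-- If the graph is bipartite and `±k`, `±k/2` are its only eigenvalues, then
`(A + k) (A² - k²/4)` is a multiple of the all-ones matrix. Comparing entries within one part of the
bipartition gives `k = 2`, six vertices, and one common neighbour for any two vertices of a part. -/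
theorem iso_cycleGraph_six_of_spectrum_subset (hconn : G.Connected) (hG : G.IsRegularOfDegree k)
    {m : ℕ} (hm : k = 2 * m) (hm0 : 0 < m) {b : V → ℝ} (hb0 : ∀ v, b v ≠ 0)
    (hb : ∀ u w, G.Adj u w → b u = -b w)
    (h : spectrum ℝ (G.adjMatrix ℝ) ⊆ {(k : ℝ), -(k : ℝ), (m : ℝ), -(m : ℝ)}) :
    k = 2 ∧ Nonempty (G ≃g cycleGraph 6) := by
  obtain ⟨c, hc, hn⟩ := exists_aeval_adjMatrix_apply_eq hconn hG
    ((X + C (k : ℝ)) * (X ^ 2 - C ((m : ℝ) ^ 2))) (by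
    intro x hx hxk
    rcases h hx with rfl | rfl | rfl | rfl
    · exact absurd rfl hxk
    · simp
    · simp
    · simp)
  have hodd : ∀ u v, b u = b v →
      G.adjMatrix ℝ u v = 0 ∧ (G.adjMatrix ℝ * G.adjMatrix ℝ ^ 2) u v = 0 := by
    intro u v huv
    have h1 : ∀ x y, b x = b y → ¬ G.Adj x y := fun x y hxy hadj =>
      hb0 x (by linarith [hb x y hadj])
    refine ⟨by rw [adjMatrix_apply, if_neg (h1 u v huv)], ?_⟩
    rw [adjMatrix_mul_apply]
    refine Finset.sum_eq_zero fun w hw => ?_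
    rw [adjMatrix_sq_apply, Nat.cast_eq_zero, Finset.card_eq_zero]
    rw [mem_neighborFinset] at hw
    ext y
    simp only [Finset.mem_inter, mem_neighborFinset, Finset.notMem_empty, iff_false, not_and]
    intro hwy hvy
    exact hb0 u (by linarith [hb u w hw, hb w y hwy, hb v y hvy])
  have hentry : ∀ u v, b u = b v →
      k * (G.adjMatrix ℝ ^ 2) u v - k * (m : ℝ) ^ 2 * (1 : Matrix V V ℝ) u v = c := by
    intro u v huv
    obtain ⟨h1, h3⟩ := hodd u v huv
    rw [← hc u v]
    simp only [map_mul, map_add, map_sub, map_pow, aeval_X, aeval_C]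
    rw [← map_pow, Algebra.algebraMap_eq_smul_one, Algebra.algebraMap_eq_smul_one, add_mul,
      mul_sub, mul_sub]
    simp only [smul_mul_assoc, one_mul, mul_smul_comm, mul_one, Matrix.add_apply,
      Matrix.sub_apply, Matrix.smul_apply, smul_eq_mul, h1, h3]
    ring
  obtain ⟨x⟩ := hconn.nonempty
  have hcx : c = k * k - k * (m : ℝ) ^ 2 := by
    rw [← hentry x x rfl, adjMatrix_sq_apply_self hG, one_apply_eq, mul_one]
  have hk' : (k : ℝ) = 2 * m := by exact_mod_cast hm
  have hm' : (0 : ℝ) < m := by exact_mod_cast hm0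
  have hn' : (Fintype.card V : ℝ) * (2 - m) = 6 * m := by
    rw [hcx] at hn
    simp only [eval_mul, eval_add, eval_sub, eval_pow, eval_X, eval_C, hk'] at hn
    have : (2 * (m : ℝ) ^ 2) ≠ 0 := by positivity
    refine mul_left_cancel₀ this ?_
    linear_combination hn
  have hm1 : m = 1 := by
    have hpos : (0 : ℝ) < Fintype.card V * (2 - m) := by
      rw [hn']
      positivity
    have h2 : (0 : ℝ) < 2 - m := pos_of_mul_pos_right hpos (by positivity)
    have h3 : (m : ℝ) < 2 := by linarith
    have : m < 2 := by exact_mod_cast h3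
    omega
  subst hm1
  have hcard : Fintype.card V = 6 := by
    have : (Fintype.card V : ℝ) = 6 := by
      push_cast at hn'
      linarith
    exact_mod_cast this
  refine ⟨hm, nonempty_iso_cycleGraph_six (by rwa [hm] at hG) hcard b hb0 hb ?_⟩
  intro v w y z hvw hvy hwy hvz hwz
  have h1 := hentry v w (by rw [hb v y hvy, hb w y hwy])
  rw [one_apply_ne hvw, adjMatrix_sq_apply, hcx, hk'] at h1
  have h2 : (G.neighborFinset v ∩ G.neighborFinset w).card = 1 := by
    have : ((G.neighborFinset v ∩ G.neighborFinset w).card : ℝ) = 1 := by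
      push_cast at h1
      linarith
    exact_mod_cast this
  exact Finset.card_le_one.1 h2.le y (by simp [hvy, hwy]) z (by simp [hvz, hwz])

/-- The classification of connected `k`-regular integral graphs all of whose eigenvalues lie in
`{±k, ±k/2, 0}`. -/
theorem classification_of_spectrum_subset (hconn : G.Connected) (hk : 0 < k)
    (hG : G.IsRegularOfDegree k)
    (hint : ∀ x ∈ spectrum ℝ (G.adjMatrix ℝ), ∃ n : ℤ, x = n)
    (h : spectrum ℝ (G.adjMatrix ℝ) ⊆ {(k : ℝ), -(k : ℝ), (k : ℝ) / 2, -((k : ℝ) / 2), 0}) :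
    (k = 2 ∧ Nonempty (G ≃g cycleGraph 6)) ∨
      Nonempty (G ≃g completeEquipartiteGraph 2 k) ∨
      (∃ m : ℕ, k = 2 * m ∧ Nonempty (G ≃g completeEquipartiteGraph 3 m)) ∨
      spectrum ℝ (G.adjMatrix ℝ) = {(k : ℝ), (k : ℝ) / 2, -((k : ℝ) / 2), 0} ∨
      spectrum ℝ (G.adjMatrix ℝ) = {(k : ℝ), -(k : ℝ), (k : ℝ) / 2, -((k : ℝ) / 2), 0} := by
  have hne := hconn.nonempty
  have hkmem := natCast_mem_spectrum hG
  set σ := spectrum ℝ (G.adjMatrix ℝ) with hσ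
  have hkpos : (0 : ℝ) < k := by exact_mod_cast hk
  have heven : (k : ℝ) / 2 ∈ σ ∨ -((k : ℝ) / 2) ∈ σ → ∃ m : ℕ, k = 2 * m := by
    have key : ∀ n : ℤ, (k : ℝ) = 2 * n → ∃ m : ℕ, k = 2 * m := fun n hn => by
      have : (k : ℤ) = 2 * n := by exact_mod_cast hn
      exact ⟨n.toNat, by omega⟩
    rintro (hx | hx)
    · obtain ⟨n, hn⟩ := hint _ hx
      exact key n (by linarith)
    · obtain ⟨n, hn⟩ := hint _ hx
      exact key (-n) (by push_cast; linarith)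
  -- With `k / 2` among the eigenvalues, so is `-k / 2`, and the presence of `-k` and `0` decides.
  by_cases hhalf : (k : ℝ) / 2 ∈ σ
  · obtain ⟨m, hm⟩ := heven (Or.inl hhalf)
    have hm' : (k : ℝ) / 2 = m := by
      rw [hm]
      push_cast
      ring
    rw [hm'] at h hhalf ⊢
    by_cases hneg : -(k : ℝ) ∈ σ
    · obtain ⟨b, hb0, hb⟩ := exists_bipartition hconn hG hneg
      have hhalf' := neg_mem_spectrum_of_bipartition hb0 hb hhalf
      by_cases h0 : (0 : ℝ) ∈ σ
      · iterate 4 right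
        refine h.antisymm ?_
        rintro x (rfl | rfl | rfl | rfl | rfl) <;> assumption
      · left
        refine iso_cycleGraph_six_of_spectrum_subset hconn hG hm (by omega) hb0 hb fun x hx => ?_
        rcases h hx with rfl | rfl | rfl | rfl | rfl
        all_goals first | exact absurd hx h0 | simp
    · have hhalf' : -(m : ℝ) ∈ σ := by
        obtain ⟨x, hx, hx0⟩ := exists_neg_mem_spectrum hk hkmem
        rcases h hx with rfl | rfl | rfl | rfl | rfl
        · linarith
        · exact absurd hx hneg
        · linarith
        · exact hx
        · exact absurd hx0 (lt_irrefl _)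
      have h0 : (0 : ℝ) ∈ σ := by
        by_contra h0
        refine not_spectrum_subset_of_half_mem hconn hG hm (by omega) hhalf fun x hx => ?_
        rcases h hx with rfl | rfl | rfl | rfl | rfl
        all_goals first | exact absurd hx h0 | exact absurd hx hneg | simp
      iterate 3 right
      left
      ext x
      constructor
      · intro hx
        rcases h hx with rfl | rfl | rfl | rfl | rfl
        all_goals first | exact absurd hx hneg | simp
      · rintro (rfl | rfl | rfl | rfl) <;> assumption
  · by_cases hnhalf : -((k : ℝ) / 2) ∈ σ
    · obtain ⟨m, hm⟩ := heven (Or.inr hnhalf)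
      have hm' : (k : ℝ) / 2 = m := by
        rw [hm]
        push_cast
        ring
      have hneg : -(k : ℝ) ∉ σ := fun hneg => by
        obtain ⟨b, hb0, hb⟩ := exists_bipartition hconn hG hneg
        exact hhalf (by simpa using neg_mem_spectrum_of_bipartition hb0 hb hnhalf)
      refine Or.inr (Or.inr (Or.inl ⟨m, hm, iso_completeEquipartiteGraph_of_spectrum_subset hconn hk
        hG (by omega) (by omega) fun x hx => ?_⟩))
      rw [← hm']
      rcases h hx with rfl | rfl | rfl | rfl | rfl
      all_goals first | exact absurd hx hneg | exact absurd hx hhalf | simp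
    · refine Or.inr (Or.inl (iso_completeEquipartiteGraph_of_spectrum_subset hconn hk hG hk
        (by omega) fun x hx => ?_))
      rcases h hx with rfl | rfl | rfl | rfl | rfl
      all_goals first | exact absurd hx hhalf | exact absurd hx hnhalf | simp

end

section

variable {V : Type*} [Fintype V] [DecidableEq V] {G : SimpleGraph V} [DecidableRel G.Adj] {k : ℕ}

/-! ### The characterization -/

theorem integral_and_periodic_of_spectrum_subset (hG : G.IsRegularOfDegree k)
    (h : spectrum ℝ (G.adjMatrix ℝ) ⊆
      {(k : ℝ), -(k : ℝ), (k : ℝ) / 2, -((k : ℝ) / 2), 0}) :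
    G.IsRegularOfDegree k ∧ IsIntegralGraph G ∧ IsPeriodic G :=
  ⟨hG, isIntegralGraph_of_adjSpectrum_subset (adjSpectrum_subset_iff.2 h),
    isPeriodic_of_adjSpectrum_subset hG (adjSpectrum_subset_iff.2 h)⟩

theorem integral_and_periodic_of_iso_cycleGraph_six (e : G ≃g cycleGraph 6) :
    G.IsRegularOfDegree 2 ∧ IsIntegralGraph G ∧ IsPeriodic G := by
  refine integral_and_periodic_of_spectrum_subset
    (isRegularOfDegree_of_iso e fun v => cycleGraph_degree_three_le) fun x hx => ?_
  rw [spectrum_adjMatrix_eq_of_iso e] at hx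
  rcases spectrum_cycleGraph_six hx with rfl | rfl | rfl | rfl <;> norm_num

theorem integral_and_periodic_of_iso_completeEquipartiteGraph_two
    (e : G ≃g completeEquipartiteGraph 2 k) :
    G.IsRegularOfDegree k ∧ IsIntegralGraph G ∧ IsPeriodic G := by
  refine integral_and_periodic_of_spectrum_subset
    (isRegularOfDegree_of_iso e (by
      simpa using isRegularOfDegree_completeEquipartiteGraph 2 k)) fun x hx => ?_
  rw [spectrum_adjMatrix_eq_of_iso e] at hx
  rcases spectrum_completeEquipartiteGraph hx with rfl | rfl | rfl
  · left
    push_cast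
    ring
  · simp
  · simp

theorem integral_and_periodic_of_iso_completeEquipartiteGraph_three {m : ℕ}
    (e : G ≃g completeEquipartiteGraph 3 m) :
    G.IsRegularOfDegree (2 * m) ∧ IsIntegralGraph G ∧ IsPeriodic G := by
  refine integral_and_periodic_of_spectrum_subset
    (isRegularOfDegree_of_iso e (by
      simpa using isRegularOfDegree_completeEquipartiteGraph 3 m)) fun x hx => ?_
  rw [spectrum_adjMatrix_eq_of_iso e] at hx
  rcases spectrum_completeEquipartiteGraph hx with rfl | rfl | rfl
  · left
    push_cast
    ring
  · simp
  · simp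

theorem spectrum_eq_of_isRegularOfDegree_zero [Nonempty V] (hG : G.IsRegularOfDegree 0) :
    spectrum ℝ (G.adjMatrix ℝ) = {0} := by
  have hA : G.adjMatrix ℝ = 0 := by
    ext u v
    rw [adjMatrix_apply, if_neg fun h => ?_, Matrix.zero_apply]
    exact (G.degree_pos_iff_exists_adj u).2 ⟨v, h⟩ |>.ne' (hG u)
  rw [hA, spectrum.zero_eq]

theorem adjSpectrum_eq_four_iff :
    adjSpectrum G = {(k : ℂ), (k : ℂ) / 2, -((k : ℂ) / 2), 0} ↔
      spectrum ℝ (G.adjMatrix ℝ) = {(k : ℝ), (k : ℝ) / 2, -((k : ℝ) / 2), 0} := by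
  rw [← adjSpectrum_eq_iff_spectrum_eq]
  simp [Set.image_insert_eq]

theorem adjSpectrum_eq_five_iff :
    adjSpectrum G = {(k : ℂ), -(k : ℂ), (k : ℂ) / 2, -((k : ℂ) / 2), 0} ↔
      spectrum ℝ (G.adjMatrix ℝ) = {(k : ℝ), -(k : ℝ), (k : ℝ) / 2, -((k : ℝ) / 2), 0} := by
  rw [← adjSpectrum_eq_iff_spectrum_eq]
  simp [Set.image_insert_eq]

end

end GroverWalk

theorem mainTheorem6 {V : Type*} [Fintype V] [DecidableEq V]
    (G : SimpleGraph V) [DecidableRel G.Adj] (hG : G.Connected) (k : ℕ) :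
    (G.IsRegularOfDegree k ∧ GroverWalk.IsIntegralGraph G ∧ GroverWalk.IsPeriodic G) ↔
      ((k = 2 ∧ Nonempty (G ≃g SimpleGraph.cycleGraph 6)) ∨
        Nonempty (G ≃g completeBipartiteGraph (Fin k) (Fin k)) ∨
        (∃ m : ℕ, k = 2 * m ∧
          Nonempty (G ≃g SimpleGraph.completeMultipartiteGraph (fun _ : Fin 3 => Fin m))) ∨
        (G.IsRegularOfDegree k ∧
          GroverWalk.adjSpectrum G = {(k : ℂ), (k : ℂ) / 2, -((k : ℂ) / 2), 0}) ∨
        (G.IsRegularOfDegree k ∧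
          GroverWalk.adjSpectrum G = {(k : ℂ), -(k : ℂ), (k : ℂ) / 2, -((k : ℂ) / 2), 0})) := by
  have hne := hG.nonempty
  rw [GroverWalk.adjSpectrum_eq_four_iff, GroverWalk.adjSpectrum_eq_five_iff]
  constructor
  · rintro ⟨hreg, hint, hper⟩
    rcases Nat.eq_zero_or_pos k with rfl | hk
    · refine Or.inr (Or.inr (Or.inr (Or.inl ⟨hreg, ?_⟩)))
      rw [GroverWalk.spectrum_eq_of_isRegularOfDegree_zero hreg]
      simp
    · have hint' : ∀ x ∈ spectrum ℝ (G.adjMatrix ℝ), ∃ n : ℤ, x = n := fun x hx => by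
        obtain ⟨n, hn⟩ := hint x ((GroverWalk.ofReal_mem_adjSpectrum_iff G x).2 hx)
        exact ⟨n, by exact_mod_cast hn⟩
      rcases GroverWalk.classification_of_spectrum_subset hG hk hreg hint'
        (GroverWalk.adjSpectrum_subset_iff.1
          (GroverWalk.adjSpectrum_subset_of_isPeriodic hk hreg hint hper)) with
        h | ⟨⟨e⟩⟩ | ⟨m, hm, ⟨e⟩⟩ | h | h
      · exact Or.inl h
      · exact Or.inr (Or.inl ⟨e.trans (GroverWalk.completeEquipartiteGraphTwoIso k)⟩)
      · exact Or.inr (Or.inr (Or.inl ⟨m, hm,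
          ⟨e.trans SimpleGraph.completeEquipartiteGraph.completeMultipartiteGraph⟩⟩))
      · exact Or.inr (Or.inr (Or.inr (Or.inl ⟨hreg, h⟩)))
      · exact Or.inr (Or.inr (Or.inr (Or.inr ⟨hreg, h⟩)))
  · rintro (⟨rfl, ⟨e⟩⟩ | ⟨⟨e⟩⟩ | ⟨m, rfl, ⟨e⟩⟩ | ⟨hreg, h⟩ | ⟨hreg, h⟩)
    · exact GroverWalk.integral_and_periodic_of_iso_cycleGraph_six e
    · exact GroverWalk.integral_and_periodic_of_iso_completeEquipartiteGraph_two
        (e.trans (GroverWalk.completeEquipartiteGraphTwoIso k).symm)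
    · exact GroverWalk.integral_and_periodic_of_iso_completeEquipartiteGraph_three
        (e.trans SimpleGraph.completeEquipartiteGraph.completeMultipartiteGraph.symm)
    · refine GroverWalk.integral_and_periodic_of_spectrum_subset hreg (h.trans_subset ?_)
      rintro x (rfl | rfl | rfl | rfl) <;> simp
    · exact GroverWalk.integral_and_periodic_of_spectrum_subset hreg h.subset
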